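/- A conjunctive regular path query (CRPQ) $Q$ is a finite non-empty conjunction of atoms $R_i(X_i,Y_i)$, each $R_i$ a regular expression, together with a set $\mathsf{free}(Q)$ of free variables among the variables occurring in the atoms; its other variables are bound. Its query graph is the undirected multigraph on its variables with one edge $\{X_i,Y_i\}$ per atom. $Q$ is acyclic if its query graph is a forest (in particular, without self-loops and parallel edges), and trivial if every connected component of the query graph contains at most one free variable. For $k\ge 2$, the $k$-expansion of $Q$ is the conjunctive query (CQ) $Q'$ with the same free variables obtained by replacing each atom $R_i(X_i,Y_i)$ by a path $S_{i,1}(X_i,Z_{i,1})\wedge S_{i,2}(Z_{i,1},Z_{i,2})\wedge\dots\wedge S_{i,k}(Z_{i,k-1},Y_i)$ of $k$ binary atoms with fresh relation symbols and fresh bound variables. For a CQ or CRPQ $P$ and a set $S$ of its variables, let $\rho^*_P(S)$ be the minimum of $\sum_a w_a$ over all assignments of weights $w_a\ge 0$ to the atoms $a$ of $P$ with $\sum_{a\ni X}w_a\ge 1$ for every $X\in S$. A tree decomposition of $P$ is a finite tree $T$ with a set $\chi(t)$ of variables for each node $t$, such that the variables of each atom are contained in some $\chi(t)$ and, for each variable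 $X$, the nodes $t$ with $X\in\chi(t)$ form a non-empty connected subtree. It is free-connex if there is a connected (possibly empty) set $U$ of nodes with $\bigcup_{t\in U}\chi(t)=\mathsf{free}(P)$. The free-connex fractional hypertree width is $\textsf{fn-fhtw}(P)=\min_{(T,\chi)}\max_{t}\rho^*_P(\chi(t))$, the minimum being over all free-connex tree decompositions of $P$. Proposition. Let $Q$ be an acyclic CRPQ, let $k\ge 2$, and let $Q'$ be the $k$-expansion of $Q$. If $Q$ is trivial, then $\textsf{fn-fhtw}(Q')=1$. If $Q$ is not trivial, then $$\textsf{fn-fhtw}(Q')=\max(\textsf{fn-fhtw}(Q),2),$$ and consequently the two output-sensitive runtime expressions agree: for all $N,\mathsf{OUT}\in\mathbb{N}$, $$N+N\cdot \mathsf{OUT}^{1-\frac{1}{\textsf{fn-fhtw}(Q')}}+\mathsf{OUT}=N+N\cdot \mathsf{OUT}^{1-\frac{1}{\max(\textsf{fn-fhtw}(Q),2)}}+\mathsf{OUT}.$$ -/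

import Mathlib

universe u

/-- The structure underlying a query: its variables `V` are the vertices, every atom `i : ι` gives
the hyperedge of the variables occurring in it, and some of the variables are free.
Every variable of a query occurs in at least one atom. -/
structure QueryHypergraph (V ι : Type u) where
  edge : ι → Set V
  free : Set V
  covers : ∀ X : V, ∃ i : ι, X ∈ edge i

namespace QueryHypergraph

variable {V ι : Type u}

open Classical in
/-- `w` is a fractional edge cover of the set `S` of variables by the hyperedges. -/
def IsFractionalEdgeCover [Fintype ι] (H : QueryHypergraph V ι) (S : Set V) (w : ι → ℝ) : Prop :=
  (∀ i, 0 ≤ w i) ∧ ∀ X ∈ S, 1 ≤ ∑ i with X ∈ H.edge i, w i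

/-- The fractional edge cover number `ρ*(S)` of a set `S` of variables. -/
noncomputable def rhoStar [Fintype ι] (H : QueryHypergraph V ι) (S : Set V) : ℝ :=
  sInf {c : ℝ | ∃ w : ι → ℝ, H.IsFractionalEdgeCover S w ∧ c = ∑ i, w i}

/-- Tree decompositions: a finite tree with a bag of variables at each node, such that every
hyperedge is contained in some bag and, for each variable, the nodes whose bags contain it form a
(nonempty) connected subtree. -/
structure TreeDecomposition (H : QueryHypergraph V ι) where
  Node : Type u
  finite_node : Finite Node
  tree : SimpleGraph Node
  isTree : tree.IsTree
  bag : Node → Set V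
  edge_subset_bag : ∀ i, ∃ t, H.edge i ⊆ bag t
  connected_nodes : ∀ X, (tree.induce {t | X ∈ bag t}).Connected

namespace TreeDecomposition

variable {H : QueryHypergraph V ι}

/-- A tree decomposition is free-connex if there is a connected (possibly empty) set of nodes whose
bags have as their union exactly the set of free variables. -/
def IsFreeConnex (D : TreeDecomposition H) : Prop :=
  ∃ U : Set D.Node, (D.tree.induce U).Preconnected ∧ ⋃ t ∈ U, D.bag t = H.free

/-- The fractional width of a tree decomposition: the maximum of `ρ*` over its bags. -/
noncomputable def width [Fintype ι] (D : TreeDecomposition H) : ℝ :=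
  ⨆ t : D.Node, H.rhoStar (D.bag t)

end TreeDecomposition

/-- The free-connex fractional hypertree width: the minimum of the fractional widths of the
free-connex tree decompositions. -/
noncomputable def fnfhtw [Fintype ι] (H : QueryHypergraph V ι) : ℝ :=
  sInf {c : ℝ | ∃ D : TreeDecomposition H, D.IsFreeConnex ∧ c = D.width}

end QueryHypergraph

/-- A conjunctive query over relation symbols `σ` with arities `ar`, with variables `V` and with
atoms indexed by `ι`: the atom `i` is `rel i (args i 0, args i 1, …)`. -/
structure CQ {σ : Type*} (ar : σ → ℕ) (V ι : Type u) where
  rel : ι → σ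
  args : (i : ι) → Fin (ar (rel i)) → V
  free : Set V
  nonempty_atoms : Nonempty ι
  covers : ∀ X : V, ∃ i : ι, X ∈ Set.range (args i)

namespace CQ

variable {σ : Type*} {ar : σ → ℕ} {V ι : Type u}

def hypergraph (Q : CQ ar V ι) : QueryHypergraph V ι where
  edge i := Set.range (Q.args i)
  free := Q.free
  covers := Q.covers

/-- The free-connex fractional hypertree width of a conjunctive query. -/
noncomputable def fnfhtw [Fintype ι] (Q : CQ ar V ι) : ℝ := Q.hypergraph.fnfhtw

/-- The expression `N + N · OUT ^ (1 - 1 / fn-fhtw(Q)) + OUT` in the best known output-sensitive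
runtime bound for acyclic conjunctive queries. -/
noncomputable def runtimeBound [Fintype ι] (Q : CQ ar V ι) (N OUT : ℝ) : ℝ :=
  N + N * OUT ^ (1 - 1 / Q.fnfhtw) + OUT

end CQ

/-- A conjunctive regular path query over the alphabet `α`, with variables `V` and with atoms
indexed by `ι`: the atom `i` is `(rpq i) (src i, tgt i)`. -/
structure CRPQ (α : Type*) (V ι : Type u) where
  rpq : ι → RegularExpression α
  src : ι → V
  tgt : ι → V
  free : Set V
  nonempty_atoms : Nonempty ι
  covers : ∀ X : V, ∃ i : ι, X = src i ∨ X = tgt i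

namespace CRPQ

variable {α : Type*} {V ι : Type u}

def hypergraph (Q : CRPQ α V ι) : QueryHypergraph V ι where
  edge i := {Q.src i, Q.tgt i}
  free := Q.free
  covers := Q.covers

/-- The free-connex fractional hypertree width of a CRPQ. -/
noncomputable def fnfhtw [Fintype ι] (Q : CRPQ α V ι) : ℝ := Q.hypergraph.fnfhtw

/-- The expression `N + N · OUT ^ (1 - 1 / max (fn-fhtw(Q)) 2) + OUT` in the output-sensitive
runtime bound for acyclic CRPQs. -/
noncomputable def runtimeBound [Fintype ι] (Q : CRPQ α V ι) (N OUT : ℝ) : ℝ :=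
  N + N * OUT ^ (1 - 1 / max Q.fnfhtw 2) + OUT

/-- The simple undirected graph underlying the query graph, which has an edge between the two
variables of every atom. -/
def queryGraph (Q : CRPQ α V ι) : SimpleGraph V :=
  SimpleGraph.fromEdgeSet (Set.range fun i => s(Q.src i, Q.tgt i))

/-- A CRPQ is acyclic if its undirected query multigraph is a forest: it has no self-loops, no
parallel edges, and no cycles. -/
def IsAcyclic (Q : CRPQ α V ι) : Prop :=
  (∀ i, Q.src i ≠ Q.tgt i) ∧
  (Function.Injective fun i => s(Q.src i, Q.tgt i)) ∧
  Q.queryGraph.IsAcyclic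

/-- A CRPQ is trivial if every connected component of its query graph contains at most one free
variable. -/
def IsTrivial (Q : CRPQ α V ι) : Prop :=
  ∀ X ∈ Q.free, ∀ Y ∈ Q.free, Q.queryGraph.Reachable X Y → X = Y

/-- The variables of the `k`-expansion: the original variables, and for every atom `k - 1` fresh
variables. -/
abbrev ExpansionVar (V ι : Type u) (k : ℕ) : Type u := V ⊕ ι × Set.Ioo 0 k

/-- The `j`-th variable, `0 ≤ j ≤ k`, on the path that replaces the atom `i`. -/
def pathVar (Q : CRPQ α V ι) (k : ℕ) (i : ι) (j : ℕ) : ExpansionVar V ι k :=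
  if h0 : j = 0 then .inl (Q.src i)
  else if hk : j < k then .inr (i, ⟨j, Nat.pos_of_ne_zero h0, hk⟩)
  else .inl (Q.tgt i)

/-- The `k`-expansion: the conjunctive query in which every atom `R(X, Y)` is replaced by a path
`S₁(X, Z₁), S₂(Z₁, Z₂), …, Sₖ(Zₖ₋₁, Y)` of `k` binary atoms with fresh relation symbols and fresh
bound variables; the free variables are unchanged. -/
def expansion (Q : CRPQ α V ι) (k : ℕ) (hk : 1 ≤ k) :
    CQ (fun _ : ι × Fin k => 2) (ExpansionVar V ι k) (ι × Fin k) where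
  rel p := p
  args p := ![Q.pathVar k p.1 p.2, Q.pathVar k p.1 (p.2 + 1)]
  free := Sum.inl '' Q.free
  nonempty_atoms := ⟨(Q.nonempty_atoms.some, ⟨0, hk⟩)⟩
  covers := by
    rintro (X | ⟨i, j, hj0, hjk⟩)
    · obtain ⟨i, rfl | rfl⟩ := Q.covers X
      · exact ⟨(i, ⟨0, hk⟩), 0, by simp [pathVar]⟩
      · refine ⟨(i, ⟨k - 1, by omega⟩), 1, ?_⟩
        have h : k - 1 + 1 = k := by omega
        have h' : k ≠ 0 := by omega
        simp [pathVar, h, h']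
    · refine ⟨(i, ⟨j, hjk⟩), 0, ?_⟩
      have h' : j ≠ 0 := by omega
      simp [pathVar, h', hjk]

end CRPQ

/-!
For an acyclic query the width is governed by the bound variables. If a connected set of bound
variables has the free neighbours `S`, then every free-connex tree decomposition has a bag that
contains `S`: the nodes that contain one of the bound variables form a subtree disjoint from the
subtree whose bags make up the free variables, and each variable of `S` occurs in both subtrees,
hence at the gate between them (`SimpleGraph.IsTree.exists_gate`,
`TreeDecomposition.exists_bag_superset`). In a forest `S` is an independent set, so the fractional
edge cover number of this bag is at least `|S|`.

This bound is attained. Root every component at a free variable if it has one, and let the set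
exposed below `c` consist of the free descendants of `c` that are reached from `c` through bound
variables. If `p` is the parent of `c`, then the bags `exposed c ∪ {c, p}`, arranged along the
forest, together with their free parts, form a free-connex tree decomposition
(`Rooting.decomposition`); an empty bag joins the components. If `c` is free, then its bag is just
`{c, p}` and costs `1`. If `c` is bound, then its bag costs at most `|exposed c| + 1`: one edge for
`{c, p}` and one edge for each exposed variable. If moreover `exposed c` is nonempty, then
`exposed c` together with the first free ancestor of `c` is a set of free neighbours as above, so
the cost does not exceed the lower bound (`Rooting.fnfhtw_le`,
`Rooting.ncard_exposed_add_one_le_fnfhtw`).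

The expansion is the subdivision of the rooted forest (`CRPQ.expansionRooting`). The exposed sets of
the original variables do not change, and a fresh variable on the path of an atom has the same
exposed set as the child end of the atom. The only new contribution comes from fresh variables below
which a single free variable that is not a root is exposed; it is `2`, and it occurs exactly if the
query is not trivial (`CRPQ.isTrivial_iff_rooting`).
-/

/-! ### Fractional edge covers -/

namespace QueryHypergraph

variable {V ι : Type u} [Fintype ι] {H : QueryHypergraph V ι}

lemma bddBelow_rhoStar (S : Set V) :
    BddBelow {c : ℝ | ∃ w : ι → ℝ, H.IsFractionalEdgeCover S w ∧ c = ∑ i, w i} := by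
  refine ⟨0, ?_⟩
  rintro c ⟨w, hw, rfl⟩
  exact Finset.sum_nonneg fun i _ => hw.1 i

lemma rhoStar_nonneg (S : Set V) : 0 ≤ H.rhoStar S := by
  refine Real.sInf_nonneg ?_
  rintro c ⟨w, hw, rfl⟩
  exact Finset.sum_nonneg fun i _ => hw.1 i

lemma rhoStar_le_card (S : Set V) (J : Finset ι) (hJ : ∀ X ∈ S, ∃ i ∈ J, X ∈ H.edge i) :
    H.rhoStar S ≤ J.card := by
  classical
  refine csInf_le (bddBelow_rhoStar S)
    ⟨fun i => if i ∈ J then 1 else 0, ⟨fun i => by dsimp only; split_ifs <;> norm_num, ?_⟩, by simp⟩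
  intro X hX
  obtain ⟨i, hi, hXi⟩ := hJ X hX
  have := Finset.single_le_sum (f := fun i => if i ∈ J then (1 : ℝ) else 0)
    (s := Finset.univ.filter fun i => X ∈ H.edge i) (a := i)
    (fun j _ => by split_ifs <;> norm_num) (by simpa using hXi)
  rw [if_pos hi] at this
  convert this

/-- Weak duality between fractional edge covers and independent sets of variables. -/
lemma card_le_rhoStar {S : Set V} (T : Finset V) (hTS : ∀ X ∈ T, X ∈ S)
    (hT : ∀ i, ∀ X ∈ T, ∀ Y ∈ T, X ∈ H.edge i → Y ∈ H.edge i → X = Y) :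
    (T.card : ℝ) ≤ H.rhoStar S := by
  classical
  refine le_csInf ?_ ?_
  · refine ⟨_, fun _ => 1, ⟨fun _ => zero_le_one, fun X _ => ?_⟩, rfl⟩
    obtain ⟨i, hi⟩ := H.covers X
    simpa using Finset.card_pos.2 ⟨i, by simpa using hi⟩
  · rintro c ⟨w, hw, rfl⟩
    calc (T.card : ℝ) = ∑ X ∈ T, (1 : ℝ) := by simp
      _ ≤ ∑ X ∈ T, ∑ i, if X ∈ H.edge i then w i else 0 := by
          refine Finset.sum_le_sum fun X hX => ?_
          have := hw.2 X (hTS X hX)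
          rw [Finset.sum_filter] at this
          convert this
      _ = ∑ i, ∑ X ∈ T, if X ∈ H.edge i then w i else 0 := Finset.sum_comm
      _ ≤ ∑ i, w i := by
          refine Finset.sum_le_sum fun i _ => ?_
          rw [← Finset.sum_filter, Finset.sum_const, nsmul_eq_mul]
          refine mul_le_of_le_one_left (hw.1 i) ?_
          exact_mod_cast Finset.card_le_one.2 fun X hX Y hY =>
            hT i X (Finset.mem_filter.1 hX).1 Y (Finset.mem_filter.1 hY).1
              (Finset.mem_filter.1 hX).2 (Finset.mem_filter.1 hY).2

lemma rhoStar_mono {S S' : Set V} (h : S ⊆ S') : H.rhoStar S ≤ H.rhoStar S' := by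
  classical
  refine csInf_le_csInf (bddBelow_rhoStar S) ?_ ?_
  · refine ⟨_, fun _ => 1, ⟨fun _ => zero_le_one, fun X _ => ?_⟩, rfl⟩
    obtain ⟨i, hi⟩ := H.covers X
    simpa using Finset.card_pos.2 ⟨i, by simpa using hi⟩
  · rintro c ⟨w, hw, rfl⟩
    exact ⟨w, ⟨hw.1, fun X hX => hw.2 X (h hX)⟩, rfl⟩

lemma fnfhtw_le_width (D : TreeDecomposition H) (hD : D.IsFreeConnex) : H.fnfhtw ≤ D.width := by
  refine csInf_le ⟨0, ?_⟩ ⟨D, hD, rfl⟩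
  rintro c ⟨D, -, rfl⟩
  exact Real.iSup_nonneg fun t => rhoStar_nonneg _

lemma TreeDecomposition.rhoStar_bag_le_width (D : TreeDecomposition H) (t : D.Node) :
    H.rhoStar (D.bag t) ≤ D.width :=
  haveI := D.finite_node
  le_ciSup (Set.finite_range fun t => H.rhoStar (D.bag t)).bddAbove t

lemma one_le_width [Nonempty V] (D : TreeDecomposition H) : 1 ≤ D.width := by
  obtain ⟨X⟩ := ‹Nonempty V›
  obtain ⟨⟨t, ht⟩⟩ := (D.connected_nodes X).nonempty
  refine le_trans ?_ (D.rhoStar_bag_le_width t)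
  simpa using card_le_rhoStar (H := H) (S := D.bag t) {X} (by simpa using ht) (by simp)

end QueryHypergraph

/-! ### Trees and connected sets of nodes -/

namespace SimpleGraph

variable {N : Type*}

/-- The graph that joins every node to its image under the parent function `f`; fixed points of `f`
have no parent. -/
def parentGraph (f : N → N) : SimpleGraph N := fromRel fun a b => f a = b

lemma parentGraph_adj {f : N → N} {a : N} (h : f a ≠ a) : (parentGraph f).Adj a (f a) := by
  simp [parentGraph, h.symm]

/-- There are at most as many edges as nodes other than the root, so connectedness suffices. -/
lemma isTree_parentGraph [Finite N] {f : N → N} (rk : N → ℕ) (r : N) (hr : f r = r)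
    (h : ∀ a, a ≠ r → rk (f a) < rk a) : (parentGraph f).IsTree := by
  have hreach : ∀ n a, rk a = n → (parentGraph f).Reachable a r := by
    intro n
    induction n using Nat.strong_induction_on with
    | _ n ih =>
      rintro a rfl
      by_cases har : a = r
      · rw [har]
      · have hlt := h a har
        exact (parentGraph_adj fun e => by rw [e] at hlt; exact lt_irrefl _ hlt).reachable.trans
          (ih _ hlt _ rfl)
  have hconn : (parentGraph f).Connected :=
    { preconnected := fun a b => (hreach _ a rfl).trans (hreach _ b rfl).symm
      nonempty := ⟨r⟩ }
  rw [isTree_iff_connected_and_card]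
  refine ⟨hconn, le_antisymm ?_ hconn.card_vert_le_card_edgeSet_add_one⟩
  have hsub : (parentGraph f).edgeSet ⊆ (fun a => s(a, f a)) '' {r}ᶜ := by
    intro e
    induction e with
    | _ a b =>
      rw [mem_edgeSet, parentGraph, fromRel_adj]
      rintro ⟨hne, rfl | rfl⟩
      · exact ⟨a, fun e => hne (by rw [Set.mem_singleton_iff.1 e, hr]), rfl⟩
      · exact ⟨b, fun e => hne (by rw [Set.mem_singleton_iff.1 e, hr]), Sym2.eq_swap⟩
  have h1 := (Set.ncard_le_ncard hsub (Set.toFinite _)).trans (Set.ncard_image_le (Set.toFinite _))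
  have h2 := Set.ncard_add_ncard_compl ({r} : Set N)
  rw [Set.ncard_singleton] at h2
  rw [Nat.card_coe_set_eq]
  omega

lemma reachable_deleteEdges_of_preconnected {G : SimpleGraph N} {S : Set N}
    (hS : (G.induce S).Preconnected) {a b : N} (hab : ¬ (a ∈ S ∧ b ∈ S)) {x y : N}
    (hx : x ∈ S) (hy : y ∈ S) : (G.deleteEdges {s(a, b)}).Reachable x y := by
  let φ : G.induce S →g G.deleteEdges {s(a, b)} :=
    { toFun := Subtype.val
      map_rel' := by
        rintro ⟨u, hu⟩ ⟨v, hv⟩ huv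
        refine (deleteEdges_adj ..).2 ⟨huv, fun e => hab ?_⟩
        rcases Sym2.eq_iff.1 (Set.mem_singleton_iff.1 e) with ⟨rfl, rfl⟩ | ⟨rfl, rfl⟩
        · exact ⟨hu, hv⟩
        · exact ⟨hv, hu⟩ }
  exact (hS ⟨x, hx⟩ ⟨y, hy⟩).map φ

/-- In a tree, all connected sets of nodes that meet both of two disjoint connected sets `A` and `B`
share a node of `B`: the endpoint in `B` of the path between `A` and `B`. -/
lemma IsTree.exists_gate {G : SimpleGraph N} (hG : G.IsTree) {A B : Set N}
    (hA : (G.induce A).Preconnected) (hB : (G.induce B).Preconnected) (hAB : Disjoint A B)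
    (hA' : A.Nonempty) (hB' : B.Nonempty) :
    ∃ t ∈ B, ∀ S : Set N, (G.induce S).Preconnected → (S ∩ A).Nonempty → (S ∩ B).Nonempty →
      t ∈ S := by
  obtain ⟨a₀, ha₀⟩ := hA'
  obtain ⟨b₀, hb₀⟩ := hB'
  have hAB' : ∀ x ∈ A, x ∈ Bᶜ := fun x hx hx' => Set.disjoint_left.1 hAB hx hx'
  -- the nodes that can be reached from `A` before entering `B`
  let C : Set N := {x | ∃ hx : x ∈ Bᶜ, (G.induce Bᶜ).Reachable ⟨a₀, hAB' _ ha₀⟩ ⟨x, hx⟩}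
  obtain ⟨p⟩ := hG.connected.preconnected a₀ b₀
  obtain ⟨⟨⟨a, t⟩, hat⟩, -, ha, ht⟩ := p.exists_boundary_dart C ⟨hAB' _ ha₀, .rfl⟩
    fun ⟨h, _⟩ => h hb₀
  dsimp only at ha ht hat
  obtain ⟨haB, har⟩ := ha
  have htB : t ∈ B := by
    by_contra htB
    exact ht ⟨htB, har.trans (Adj.reachable (by simpa using hat))⟩
  refine ⟨t, htB, fun S hS ⟨x, hxS, hxA⟩ ⟨y, hyS, hyB⟩ => ?_⟩
  by_contra htS
  have hbr := isAcyclic_iff_forall_adj_isBridge.1 hG.isAcyclic hat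
  rw [isBridge_iff] at hbr
  refine hbr ?_
  have h1 : (G.deleteEdges {s(a, t)}).Reachable a₀ a := by
    let φ : G.induce Bᶜ →g G.deleteEdges {s(a, t)} :=
      { toFun := Subtype.val
        map_rel' := by
          rintro ⟨u, hu⟩ ⟨v, hv⟩ huv
          refine (deleteEdges_adj ..).2 ⟨huv, fun e => ?_⟩
          rcases Sym2.eq_iff.1 (Set.mem_singleton_iff.1 e) with ⟨rfl, rfl⟩ | ⟨rfl, rfl⟩
          · exact hv htB
          · exact hu htB }
    exact har.map φ
  have h2 := reachable_deleteEdges_of_preconnected hA (a := a) (b := t)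
    (fun h => hAB' _ h.2 htB) ha₀ hxA
  have h3 := reachable_deleteEdges_of_preconnected hS (a := a) (b := t) (fun h => htS h.2) hxS hyS
  have h4 := reachable_deleteEdges_of_preconnected hB (a := a) (b := t) (fun h => haB h.1) hyB htB
  exact ((h1.symm.trans h2).trans h3).trans h4

end SimpleGraph

namespace QueryHypergraph

variable {V ι : Type u}

/-! ### Rooted forests -/

/-- `Exposed par free c x`: the free variable `x` is a descendant of `c` (or `c` itself), and all
variables strictly above `x`, up to and including `c`, are bound. -/
inductive Exposed (par : V → V) (free : Set V) : V → V → Prop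
  | refl {x : V} : x ∈ free → Exposed par free x x
  | step {c x : V} : Exposed par free c x → par c ∉ free → Exposed par free (par c) x

/-- A presentation of a query hypergraph as a rooted forest: the hyperedges are the pairs of a
variable and its parent. Roots are encoded as their own parents. Every root is free, unless no free
variable is exposed below it. -/
structure Rooting (H : QueryHypergraph V ι) where
  par : V → V
  depth : V → ℕ
  depth_lt : ∀ c, par c ≠ c → depth (par c) < depth c
  edge_eq : ∀ i, ∃ c, par c ≠ c ∧ H.edge i = {c, par c}
  exists_edge : ∀ c, par c ≠ c → ∃ i, H.edge i = {c, par c}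
  root_free : ∀ c x, par c = c → c ∉ H.free → ¬ Exposed par H.free c x

namespace Rooting

variable {H : QueryHypergraph V ι} (R : H.Rooting)

/-- The set of the free variables exposed below `c`. -/
def exposed (c : V) : Set V := {x | Exposed R.par H.free c x}

lemma exposed_subset_free (c : V) : R.exposed c ⊆ H.free := by
  intro x hx
  induction hx with
  | refl h => exact h
  | step _ _ ih => exact ih

lemma mem_exposed_self {x : V} (hx : x ∈ H.free) : x ∈ R.exposed x := .refl hx

lemma exposed_subset_exposed_par {c : V} (h : R.par c ∉ H.free) :
    R.exposed c ⊆ R.exposed (R.par c) := fun _ hx => Exposed.step hx h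

lemma eq_or_par_not_mem_free {c x : V} (hx : x ∈ R.exposed c) : x = c ∨ R.par x ∉ H.free := by
  induction hx with
  | refl h => exact .inl rfl
  | step _ h ih => exact .inr (by rcases ih with rfl | ih; exacts [h, ih])

lemma depth_par_le (c : V) : R.depth (R.par c) ≤ R.depth c := by
  by_cases h : R.par c = c
  · rw [h]
  · exact (R.depth_lt c h).le

lemma depth_le_of_mem_exposed {c x : V} (hx : x ∈ R.exposed c) : R.depth c ≤ R.depth x := by
  induction hx with
  | refl h => exact le_rfl
  | step _ _ ih => exact (R.depth_par_le _).trans ih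

lemma exposed_of_mem_free {c : V} (hc : c ∈ H.free) : R.exposed c = {c} := by
  refine Set.Subset.antisymm ?_ (by simpa using R.mem_exposed_self hc)
  intro x hx
  cases hx with
  | refl h => rfl
  | step _ h => exact absurd hc h

lemma par_ne_of_mem_exposed {c x : V} (hc : c ∉ H.free) (hx : x ∈ R.exposed c) :
    R.par c ≠ c := fun h => R.root_free c x h hc hx

lemma exists_subset_edge (c : V) : ∃ i, {c, R.par c} ⊆ H.edge i := by
  by_cases h : R.par c = c
  · obtain ⟨i, hi⟩ := H.covers c
    exact ⟨i, by simpa [h] using hi⟩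
  · obtain ⟨i, hi⟩ := R.exists_edge c h
    exact ⟨i, hi.ge⟩

/-! ### A free-connex tree decomposition of a rooted forest -/

/-- The nodes of the tree decomposition: an empty root bag, and for each variable `c` a bag of free
variables and a bag that contains `c` and its parent. -/
inductive DecompNode (V : Type u) : Type u
  | root : DecompNode V
  | freeBag : V → DecompNode V
  | edgeBag : V → DecompNode V

open DecompNode

instance [Finite V] : Finite (DecompNode V) :=
  Finite.of_surjective (α := Option (V ⊕ V))
    (fun | none => root | some (.inl c) => freeBag c | some (.inr c) => edgeBag c)
    (by
      rintro (_ | c | c)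
      exacts [⟨none, rfl⟩, ⟨some (.inl c), rfl⟩, ⟨some (.inr c), rfl⟩])

open Classical in
/-- The parent function of the decomposition tree. The free bags follow the forest; the edge bags
follow it as long as the parent variable is bound, and hang from a free bag otherwise. -/
noncomputable def nodePar : DecompNode V → DecompNode V
  | root => root
  | freeBag c => if R.par c = c then root else freeBag (R.par c)
  | edgeBag c => if R.par c = c ∨ R.par c ∈ H.free then freeBag c else edgeBag (R.par c)

/-- The bags of the decomposition. -/
def nodeBag : DecompNode V → Set V
  | root => ∅
  | freeBag c => R.exposed c ∪ ({R.par c} ∩ H.free)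
  | edgeBag c => R.exposed c ∪ {c, R.par c}

/-- The rank that decreases towards the root of the decomposition tree. -/
def nodeRank : DecompNode V → ℕ
  | root => 0
  | freeBag c => R.depth c + 1
  | edgeBag c => R.depth c + 2

lemma nodeRank_nodePar_lt (a : DecompNode V) (ha : a ≠ root) :
    R.nodeRank (R.nodePar a) < R.nodeRank a := by
  rcases a with _ | c | c
  · exact absurd rfl ha
  · by_cases h : R.par c = c
    · simp [nodePar, h, nodeRank]
    · simpa [nodePar, h, nodeRank] using R.depth_lt c h
  · by_cases h : R.par c = c ∨ R.par c ∈ H.free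
    · simp [nodePar, h, nodeRank]
    · simp only [nodePar, if_neg h, nodeRank]
      have := R.depth_lt c fun e => h (.inl e)
      omega

lemma nodeTree_adj (a : DecompNode V) (ha : a ≠ root) :
    (SimpleGraph.parentGraph R.nodePar).Adj a (R.nodePar a) :=
  SimpleGraph.parentGraph_adj fun e => by
    have := R.nodeRank_nodePar_lt a ha
    rw [e] at this
    exact lt_irrefl _ this

lemma freeBag_adj {c : V} (h : R.par c ≠ c) :
    (SimpleGraph.parentGraph R.nodePar).Adj (freeBag c) (freeBag (R.par c)) := by
  have := R.nodeTree_adj (freeBag c) (by simp)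
  rwa [nodePar, if_neg h] at this

lemma edgeBag_adj_freeBag {c : V} (h : R.par c = c ∨ R.par c ∈ H.free) :
    (SimpleGraph.parentGraph R.nodePar).Adj (edgeBag c) (freeBag c) := by
  have := R.nodeTree_adj (edgeBag c) (by simp)
  rwa [nodePar, if_pos h] at this

lemma edgeBag_adj_edgeBag {c : V} (h : ¬ (R.par c = c ∨ R.par c ∈ H.free)) :
    (SimpleGraph.parentGraph R.nodePar).Adj (edgeBag c) (edgeBag (R.par c)) := by
  have := R.nodeTree_adj (edgeBag c) (by simp)
  rwa [nodePar, if_neg h] at this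

lemma freeBag_reachable {x c : V} (hx : x ∈ R.exposed c) :
    ∃ (h : freeBag c ∈ {t | x ∈ R.nodeBag t}) (h' : freeBag x ∈ {t | x ∈ R.nodeBag t}),
      ((SimpleGraph.parentGraph R.nodePar).induce {t | x ∈ R.nodeBag t}).Reachable
        ⟨freeBag c, h⟩ ⟨freeBag x, h'⟩ := by
  have hxf := R.exposed_subset_free c hx
  refine ⟨.inl hx, .inl (R.mem_exposed_self hxf), ?_⟩
  induction hx with
  | refl h => exact .rfl
  | @step c x hx h ih =>
    have hx' : x ∈ R.exposed c := hx
    refine .trans ?_ (ih hxf)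
    by_cases hc : R.par c = c
    · have : freeBag (R.par c) = freeBag c := by rw [hc]
      simp only [this]
      exact .rfl
    · exact (SimpleGraph.Adj.reachable (by simpa using R.freeBag_adj hc)).symm

lemma edgeBag_reachable {x c : V} (hx : x ∈ R.exposed c) :
    ∃ (h : edgeBag c ∈ {t | x ∈ R.nodeBag t}) (h' : freeBag x ∈ {t | x ∈ R.nodeBag t}),
      ((SimpleGraph.parentGraph R.nodePar).induce {t | x ∈ R.nodeBag t}).Reachable
        ⟨edgeBag c, h⟩ ⟨freeBag x, h'⟩ := by
  induction hn : R.depth c using Nat.strong_induction_on generalizing c with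
  | _ n ih =>
    subst hn
    by_cases h : R.par c = c ∨ R.par c ∈ H.free
    · obtain ⟨h1, h2, h3⟩ := R.freeBag_reachable hx
      exact ⟨.inl hx, h2, .trans (SimpleGraph.Adj.reachable
        (by simpa using R.edgeBag_adj_freeBag h)) h3⟩
    · obtain ⟨h1, h2, h3⟩ := ih _ (R.depth_lt c fun e => h (.inl e))
        (R.exposed_subset_exposed_par (fun e => h (.inr e)) hx) rfl
      exact ⟨.inl hx, h2, .trans (SimpleGraph.Adj.reachable
        (by simpa using R.edgeBag_adj_edgeBag h)) h3⟩

lemma connected_of_mem_free {x : V} (hx : x ∈ H.free) :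
    ((SimpleGraph.parentGraph R.nodePar).induce {t | x ∈ R.nodeBag t}).Connected := by
  have hx0 : freeBag x ∈ {t | x ∈ R.nodeBag t} := .inl (R.mem_exposed_self hx)
  have key : ∀ t : {t | x ∈ R.nodeBag t}, ((SimpleGraph.parentGraph R.nodePar).induce
      {t | x ∈ R.nodeBag t}).Reachable t ⟨freeBag x, hx0⟩ := by
    have hfree : ∀ c (h : x ∈ R.nodeBag (freeBag c)), ((SimpleGraph.parentGraph R.nodePar).induce
        {t | x ∈ R.nodeBag t}).Reachable ⟨freeBag c, h⟩ ⟨freeBag x, hx0⟩ := by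
      rintro c (h | ⟨h, -⟩)
      · exact (R.freeBag_reachable h).2.2
      · rw [Set.mem_singleton_iff] at h
        by_cases hc : R.par c = c
        · obtain rfl : x = c := h.trans hc
          exact .rfl
        · subst h
          exact SimpleGraph.Adj.reachable (by simpa using R.freeBag_adj hc)
    rintro ⟨_ | c | c, h⟩
    · exact absurd h (Set.notMem_empty x)
    · exact hfree c h
    · rcases id h with h' | h' | h'
      · exact (R.edgeBag_reachable h').2.2
      · subst h'
        exact (R.edgeBag_reachable (R.mem_exposed_self hx)).2.2
      · rw [Set.mem_singleton_iff] at h'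
        have hc : x ∈ R.nodeBag (freeBag c) := .inr ⟨h', hx⟩
        refine .trans (SimpleGraph.Adj.reachable ?_) (hfree c hc)
        simpa using R.edgeBag_adj_freeBag (.inr (h' ▸ hx))
  exact { preconnected := fun a b => (key a).trans (key b).symm, nonempty := ⟨⟨_, hx0⟩⟩ }

lemma connected_of_not_mem_free {x : V} (hx : x ∉ H.free) :
    ((SimpleGraph.parentGraph R.nodePar).induce {t | x ∈ R.nodeBag t}).Connected := by
  have hx0 : edgeBag x ∈ {t | x ∈ R.nodeBag t} := .inr (.inl rfl)
  have key : ∀ t : {t | x ∈ R.nodeBag t}, ((SimpleGraph.parentGraph R.nodePar).induce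
      {t | x ∈ R.nodeBag t}).Reachable t ⟨edgeBag x, hx0⟩ := by
    rintro ⟨_ | c | c, h⟩
    · exact absurd h (Set.notMem_empty x)
    · rcases h with h | ⟨-, h⟩
      · exact absurd (R.exposed_subset_free c h) hx
      · exact absurd h hx
    · rcases id h with h' | h' | h'
      · exact absurd (R.exposed_subset_free c h') hx
      · subst h'
        exact .rfl
      · rw [Set.mem_singleton_iff] at h'
        by_cases hc : R.par c = c
        · obtain rfl : x = c := h'.trans hc
          exact .rfl
        · subst h'
          exact SimpleGraph.Adj.reachable
            (by simpa using R.edgeBag_adj_edgeBag (not_or.2 ⟨hc, hx⟩))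
  exact { preconnected := fun a b => (key a).trans (key b).symm, nonempty := ⟨⟨_, hx0⟩⟩ }

/-- The tree decomposition of a rooted forest into the bags `nodeBag`. -/
noncomputable def decomposition [Finite V] : TreeDecomposition H where
  Node := DecompNode V
  finite_node := inferInstance
  tree := SimpleGraph.parentGraph R.nodePar
  isTree := SimpleGraph.isTree_parentGraph R.nodeRank root rfl R.nodeRank_nodePar_lt
  bag := R.nodeBag
  edge_subset_bag i := by
    obtain ⟨c, -, hi⟩ := R.edge_eq i
    exact ⟨edgeBag c, hi.trans_subset Set.subset_union_right⟩
  connected_nodes x := by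
    by_cases hx : x ∈ H.free
    · exact R.connected_of_mem_free hx
    · exact R.connected_of_not_mem_free hx

lemma isFreeConnex_decomposition [Finite V] : R.decomposition.IsFreeConnex := by
  let U : Set (DecompNode V) := {t | ∀ c, t ≠ edgeBag c}
  have hroot : root ∈ U := fun c => by simp
  have hfree : ∀ c, freeBag c ∈ U := fun c d => by simp
  refine ⟨U, ?_, ?_⟩
  · have key : ∀ n c, R.depth c = n → ((SimpleGraph.parentGraph R.nodePar).induce U).Reachable
        ⟨freeBag c, hfree c⟩ ⟨root, hroot⟩ := by
      intro n
      induction n using Nat.strong_induction_on with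
      | _ n ih =>
        rintro c rfl
        by_cases hc : R.par c = c
        · refine SimpleGraph.Adj.reachable ?_
          have := R.nodeTree_adj (freeBag c) (by simp)
          rw [nodePar, if_pos hc] at this
          simpa using this
        · exact .trans (SimpleGraph.Adj.reachable (by simpa using R.freeBag_adj hc))
            (ih _ (R.depth_lt c hc) _ rfl)
    have key' : ∀ t : U, ((SimpleGraph.parentGraph R.nodePar).induce U).Reachable
        t ⟨root, hroot⟩ := by
      rintro ⟨_ | c | c, h⟩
      · exact .rfl
      · exact key _ c rfl
      · exact absurd rfl (h c)
    exact fun a b => (key' a).trans (key' b).symm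
  · change ⋃ t ∈ U, R.nodeBag t = H.free
    refine Set.Subset.antisymm (Set.iUnion₂_subset ?_) fun x hx => ?_
    · rintro (_ | c | c) h
      · exact Set.empty_subset _
      · exact Set.union_subset (R.exposed_subset_free c) Set.inter_subset_right
      · exact absurd rfl (h c)
    · exact Set.mem_biUnion (hfree x) (.inl (R.mem_exposed_self hx))

/-- The upper bound on the width: `c` and its parent share an edge, and the free variables exposed
below a bound `c` are covered by one edge each. -/
lemma width_decomposition_le [Finite V] [Fintype ι] {W : ℝ} (h1 : 1 ≤ W)
    (hW : ∀ c ∉ H.free, ((R.exposed c).ncard : ℝ) + 1 ≤ W) : R.decomposition.width ≤ W := by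
  classical
  have : Nonempty R.decomposition.Node := ⟨(root : DecompNode V)⟩
  have hedge : ∀ c, H.rhoStar (R.nodeBag (edgeBag c)) ≤ W := by
    intro c
    obtain ⟨i, hi⟩ := R.exists_subset_edge c
    by_cases hc : c ∈ H.free
    · refine le_trans (rhoStar_le_card _ {i} fun X hX => ⟨i, by simp, hi ?_⟩) (by simpa using h1)
      rw [nodeBag, R.exposed_of_mem_free hc] at hX
      rcases hX with hX | hX
      · exact .inl hX
      · exact hX
    · choose e he using H.covers
      have hfin : (R.exposed c).Finite := Set.toFinite _
      refine le_trans (rhoStar_le_card _ (insert i (hfin.toFinset.image e)) fun X hX => ?_) ?_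
      · rcases hX with hX | hX
        · exact ⟨e X, Finset.mem_insert_of_mem
            (Finset.mem_image_of_mem _ (hfin.mem_toFinset.2 hX)), he X⟩
        · exact ⟨i, Finset.mem_insert_self _ _, hi hX⟩
      · refine le_trans ?_ (hW c hc)
        rw [Set.ncard_eq_toFinset_card _ hfin]
        exact_mod_cast (Finset.card_insert_le _ _).trans
          (Nat.add_le_add_right Finset.card_image_le 1)
  refine ciSup_le fun t => ?_
  change H.rhoStar (R.nodeBag t) ≤ W
  rcases t with _ | c | c
  · exact (rhoStar_le_card _ ∅ fun X hX => hX.elim).trans (by simpa using zero_le_one.trans h1)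
  · refine (rhoStar_mono ?_).trans (hedge c)
    exact Set.union_subset_union_right _ fun x hx => .inr hx.1
  · exact hedge c

end Rooting

end QueryHypergraph

namespace QueryHypergraph

variable {V ι : Type u} {H : QueryHypergraph V ι}

/-! ### Lower bound on the width -/

/-- The variables `a` and `b` share an atom, and `b` is bound. -/
def BoundStep (H : QueryHypergraph V ι) (a b : V) : Prop :=
  b ∉ H.free ∧ ∃ i, a ∈ H.edge i ∧ b ∈ H.edge i

/-- The bound variable `c` is connected to `s` by a path of bound variables. -/
def BoundConnected (H : QueryHypergraph V ι) (c s : V) : Prop :=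
  ∃ y, Relation.ReflTransGen H.BoundStep c y ∧ ∃ i, s ∈ H.edge i ∧ y ∈ H.edge i

lemma BoundConnected.head {c d s : V} (h : H.BoundStep c d) (hd : H.BoundConnected d s) :
    H.BoundConnected c s := by
  obtain ⟨y, hy, hi⟩ := hd
  exact ⟨y, .head h hy, hi⟩

/-- The free variables adjacent to a connected set of bound variables lie in a common bag: the
nodes containing one of the bound variables form a connected set disjoint from the connected set of
nodes that witnesses free-connexity, and each of the free variables occurs in both. -/
lemma TreeDecomposition.exists_bag_superset (D : TreeDecomposition H) (hD : D.IsFreeConnex) {c : V}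
    (hc : c ∉ H.free) {S : Set V} (hS : S ⊆ H.free) (hne : S.Nonempty)
    (h : ∀ s ∈ S, H.BoundConnected c s) : ∃ t, S ⊆ D.bag t := by
  obtain ⟨U, hU, hUfree⟩ := hD
  let B : Set D.Node := {t | ∃ y, Relation.ReflTransGen H.BoundStep c y ∧ y ∈ D.bag t}
  have hbound : ∀ y, Relation.ReflTransGen H.BoundStep c y → y ∉ H.free := by
    intro y hy
    rcases hy.cases_tail with rfl | ⟨z, -, hz⟩
    exacts [hc, hz.1]
  obtain ⟨⟨t₀, ht₀⟩⟩ := (D.connected_nodes c).nonempty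
  have ht₀B : t₀ ∈ B := ⟨c, .refl, ht₀⟩
  have hnode : ∀ y, Relation.ReflTransGen H.BoundStep c y → ∀ t t' (ht : t ∈ B) (ht' : t' ∈ B),
      y ∈ D.bag t → y ∈ D.bag t' → (D.tree.induce B).Reachable ⟨t, ht⟩ ⟨t', ht'⟩ := by
    intro y hy t t' ht ht' hyt hyt'
    have hsub : {t | y ∈ D.bag t} ⊆ B := fun t ht => ⟨y, hy, ht⟩
    exact ((D.connected_nodes y).preconnected ⟨t, hyt⟩ ⟨t', hyt'⟩).map
      (D.tree.induceHomOfLE hsub).toHom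
  have hreach : ∀ y, Relation.ReflTransGen H.BoundStep c y → ∀ t (ht : t ∈ B), y ∈ D.bag t →
      (D.tree.induce B).Reachable ⟨t, ht⟩ ⟨t₀, ht₀B⟩ := by
    intro y hy
    induction hy with
    | refl => exact fun t ht hct => hnode c .refl t t₀ ht ht₀B hct ht₀
    | @tail a b hca hab ih =>
      intro t ht hbt
      obtain ⟨-, i, ha, hb⟩ := id hab
      obtain ⟨t₁, ht₁⟩ := D.edge_subset_bag i
      have ht₁B : t₁ ∈ B := ⟨a, hca, ht₁ ha⟩
      exact (hnode b (hca.tail hab) t t₁ ht ht₁B hbt (ht₁ hb)).trans (ih t₁ ht₁B (ht₁ ha))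
  have hB : (D.tree.induce B).Preconnected := by
    rintro ⟨t, ht⟩ ⟨t', ht'⟩
    obtain ⟨y, hy, hyt⟩ := id ht
    obtain ⟨y', hy', hyt'⟩ := id ht'
    exact (hreach y hy t ht hyt).trans (hreach y' hy' t' ht' hyt').symm
  have hUfree' : ∀ t ∈ U, D.bag t ⊆ H.free := fun t ht =>
    hUfree ▸ Set.subset_biUnion_of_mem (u := D.bag) ht
  have hmeetU : ∀ s ∈ S, ({t | s ∈ D.bag t} ∩ U).Nonempty := by
    intro s hs
    have : s ∈ ⋃ t ∈ U, D.bag t := hUfree ▸ hS hs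
    obtain ⟨t, ht, hst⟩ := Set.mem_iUnion₂.1 this
    exact ⟨t, hst, ht⟩
  obtain ⟨s₀, hs₀⟩ := hne
  obtain ⟨u, -, hu⟩ := hmeetU s₀ hs₀
  obtain ⟨t, -, ht⟩ := D.isTree.exists_gate hU hB
    (Set.disjoint_left.2 fun t htU ⟨y, hy, hyt⟩ => hbound y hy (hUfree' t htU hyt))
    ⟨u, hu⟩ ⟨t₀, ht₀B⟩
  refine ⟨t, fun s hs => ht {t | s ∈ D.bag t} (D.connected_nodes s).preconnected
    (hmeetU s hs) ?_⟩
  obtain ⟨y, hy, i, hsi, hyi⟩ := h s hs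
  obtain ⟨t₁, ht₁⟩ := D.edge_subset_bag i
  exact ⟨t₁, ht₁ hsi, y, hy, ht₁ hyi⟩

namespace Rooting

variable (R : H.Rooting)

lemma boundConnected_of_mem_exposed {c x : V} (hc : c ∉ H.free) (hx : x ∈ R.exposed c) :
    H.BoundConnected c x := by
  induction hx with
  | refl h => exact absurd h hc
  | @step d x hx h ih =>
    obtain ⟨i, hi⟩ := R.exists_subset_edge d
    by_cases hd : d ∈ H.free
    · have hx' : x ∈ R.exposed d := hx
      rw [R.exposed_of_mem_free hd] at hx'
      obtain rfl := Set.mem_singleton_iff.1 hx'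
      exact ⟨_, .refl, i, hi (.inl rfl), hi (.inr rfl)⟩
    · exact (ih hd).head ⟨hd, i, hi (.inr rfl), hi (.inl rfl)⟩

/-- A bound variable with an exposed free variable below it has a free variable above it. -/
lemma exists_free_ancestor {c x : V} (hc : c ∉ H.free) (hx : x ∈ R.exposed c) :
    ∃ p ∈ H.free, R.depth p < R.depth c ∧ H.BoundConnected c p := by
  induction hn : R.depth c using Nat.strong_induction_on generalizing c with
  | _ n ih =>
    subst hn
    have hlt := R.depth_lt c (R.par_ne_of_mem_exposed hc hx)
    obtain ⟨i, hi⟩ := R.exists_subset_edge c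
    by_cases hp : R.par c ∈ H.free
    · exact ⟨_, hp, hlt, _, .refl, i, hi (.inr rfl), hi (.inl rfl)⟩
    · obtain ⟨p, hpf, hpd, hcon⟩ := ih _ hlt hp (R.exposed_subset_exposed_par hp hx) rfl
      exact ⟨p, hpf, hpd.trans hlt, hcon.head ⟨hp, i, hi (.inl rfl), hi (.inr rfl)⟩⟩

/-- Some bag contains the free variables exposed below `c` together with a free variable above `c`,
and these variables are pairwise non-adjacent. -/
lemma ncard_exposed_add_one_le_width [Fintype ι] [Finite V] {c : V} (hc : c ∉ H.free)
    (hne : (R.exposed c).Nonempty) (D : TreeDecomposition H) (hD : D.IsFreeConnex) :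
    ((R.exposed c).ncard : ℝ) + 1 ≤ D.width := by
  classical
  obtain ⟨x, hx⟩ := hne
  obtain ⟨p, hpf, hpd, hcon⟩ := R.exists_free_ancestor hc hx
  obtain ⟨t, ht⟩ := D.exists_bag_superset hD hc (S := insert p (R.exposed c))
    (Set.insert_subset hpf (R.exposed_subset_free c)) ⟨p, .inl rfl⟩ (by
      rintro s (rfl | hs)
      exacts [hcon, R.boundConnected_of_mem_exposed hc hs])
  have hfin : (R.exposed c).Finite := Set.toFinite _
  have hp : p ∉ R.exposed c := fun h => (R.depth_le_of_mem_exposed h).not_gt hpd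
  -- the parent of an exposed variable is bound, and the parent of `p` lies too high
  have hpar : ∀ s ∈ insert p (R.exposed c), R.par s ∉ insert p (R.exposed c) ∨ R.par s = s := by
    rintro s (rfl | hs)
    · refine or_iff_not_imp_right.2 fun hps h => ?_
      rcases h with h | h
      · exact hps h
      · exact ((R.depth_le_of_mem_exposed h).trans (R.depth_par_le s)).not_gt hpd
    · refine .inl fun h => ?_
      have hf : R.par s ∈ H.free := by
        rcases h with h | h
        exacts [h ▸ hpf, R.exposed_subset_free c h]
      rcases R.eq_or_par_not_mem_free hs with rfl | h'
      exacts [hc (R.exposed_subset_free _ hs), h' hf]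
  refine le_trans ?_ (D.rhoStar_bag_le_width t)
  have := card_le_rhoStar (H := H) (S := D.bag t) (insert p hfin.toFinset)
    (fun s hs => ht (by simpa using hs)) (by
      intro i s hs s' hs' hsi hsi'
      replace hs : s ∈ insert p (R.exposed c) := by simpa using hs
      replace hs' : s' ∈ insert p (R.exposed c) := by simpa using hs'
      obtain ⟨d, hd, hi⟩ := R.edge_eq i
      rw [hi] at hsi hsi'
      rcases hsi with rfl | rfl <;> rcases hsi' with rfl | rfl
      · rfl
      · exact ((hpar _ hs).resolve_left (not_not.2 hs')).symm
      · exact (hpar _ hs').resolve_left (not_not.2 hs)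
      · rfl)
  rw [Finset.card_insert_of_notMem (by simpa using hp), ← Set.ncard_eq_toFinset_card _ hfin] at this
  exact_mod_cast this

variable [Fintype ι] [Finite V]

lemma one_le_fnfhtw [Nonempty V] (R : H.Rooting) : 1 ≤ H.fnfhtw := by
  refine le_csInf ⟨_, R.decomposition, R.isFreeConnex_decomposition, rfl⟩ ?_
  rintro _ ⟨D, -, rfl⟩
  exact one_le_width D

lemma ncard_exposed_add_one_le_fnfhtw {c : V} (hc : c ∉ H.free) (hne : (R.exposed c).Nonempty) :
    ((R.exposed c).ncard : ℝ) + 1 ≤ H.fnfhtw := by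
  refine le_csInf ⟨_, R.decomposition, R.isFreeConnex_decomposition, rfl⟩ ?_
  rintro _ ⟨D, hD, rfl⟩
  exact R.ncard_exposed_add_one_le_width hc hne D hD

lemma fnfhtw_le {W : ℝ} (h1 : 1 ≤ W)
    (hW : ∀ c ∉ H.free, (R.exposed c).Nonempty → ((R.exposed c).ncard : ℝ) + 1 ≤ W) :
    H.fnfhtw ≤ W := by
  refine (fnfhtw_le_width _ R.isFreeConnex_decomposition).trans
    (R.width_decomposition_le h1 fun c hc => ?_)
  rcases (R.exposed c).eq_empty_or_nonempty with h | h
  · simpa [h] using h1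
  · exact hW c hc h

end Rooting

end QueryHypergraph

namespace CRPQ

variable {α : Type*} {V ι : Type u} {Q : CRPQ α V ι}

lemma finite_var [Finite ι] (Q : CRPQ α V ι) : Finite V := by
  refine Finite.of_surjective (Sum.elim Q.src Q.tgt) fun X => ?_
  obtain ⟨i, h | h⟩ := Q.covers X
  exacts [⟨.inl i, h.symm⟩, ⟨.inr i, h.symm⟩]

lemma nonempty_var (Q : CRPQ α V ι) : Nonempty V := ⟨Q.src Q.nonempty_atoms.some⟩

/-! ### Rooting an acyclic query -/

lemma queryGraph_adj_iff {X Y : V} :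
    Q.queryGraph.Adj X Y ↔ (∃ i, s(Q.src i, Q.tgt i) = s(X, Y)) ∧ X ≠ Y := by
  simp [queryGraph]

lemma hypergraph_edge_eq {i : ι} {X Y : V} (h : s(Q.src i, Q.tgt i) = s(X, Y)) :
    Q.hypergraph.edge i = {X, Y} := by
  rcases Sym2.eq_iff.1 h with ⟨rfl, rfl⟩ | ⟨rfl, rfl⟩
  exacts [rfl, Set.pair_comm _ _]

/-- In every component, a free variable is chosen as the root if there is one; the parent of a
variable is its successor on the path to the root. -/
lemma exists_rooting (hQ : Q.IsAcyclic) : Nonempty Q.hypergraph.Rooting := by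
  classical
  obtain ⟨hloop, -, hac⟩ := hQ
  have hroot : ∀ C : Q.queryGraph.ConnectedComponent, ∃ r,
      Q.queryGraph.connectedComponentMk r = C ∧
      ∀ x ∈ Q.free, Q.queryGraph.connectedComponentMk x = C → r ∈ Q.free := by
    intro C
    by_cases h : ∃ x ∈ Q.free, Q.queryGraph.connectedComponentMk x = C
    · obtain ⟨x, hx, hxC⟩ := h
      exact ⟨x, hxC, fun _ _ _ => hx⟩
    · obtain ⟨r, hr⟩ := C.exists_rep
      exact ⟨r, hr, fun x hx hxC => absurd ⟨x, hx, hxC⟩ h⟩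
  choose rt hrt hrtfree using hroot
  let r : V → V := fun v => rt (Q.queryGraph.connectedComponentMk v)
  have hr : ∀ v, Q.queryGraph.Reachable v (r v) := fun v =>
    SimpleGraph.ConnectedComponent.exact (hrt _).symm
  have hradj : ∀ v w, Q.queryGraph.Reachable v w → r v = r w := fun v w h =>
    congrArg rt (SimpleGraph.ConnectedComponent.sound h)
  choose p hp using fun v => (hr v).exists_isPath
  have huniq : ∀ v r' (q : Q.queryGraph.Walk v r'), r' = r v → q.IsPath →
      (p v).snd = q.snd ∧ (p v).length = q.length := by
    rintro v _ q rfl hq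
    have : p v = q := congrArg Subtype.val ((hac.subsingleton_path _ _).elim ⟨p v, hp v⟩ ⟨q, hq⟩)
    rw [this]
    exact ⟨rfl, rfl⟩
  have hsnd : ∀ v, (p v).Nil → (p v).snd = r v := fun v hnil =>
    SimpleGraph.Walk.getVert_of_length_le _
      (by simp [SimpleGraph.Walk.length_eq_zero_iff.2 hnil])
  have hreach : ∀ v, Q.queryGraph.Reachable v (p v).snd := fun v => by
    by_cases hnil : (p v).Nil
    · rw [hsnd v hnil]
      exact hr v
    · exact (SimpleGraph.Walk.adj_snd hnil).reachable
  have hnotnil : ∀ v, (p v).snd ≠ v → ¬ (p v).Nil := fun v hv hnil =>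
    hv ((hsnd v hnil).trans hnil.eq.symm)
  have hpar : ∀ v w, Q.queryGraph.Adj v w → (p v).snd = w ∨ (p w).snd = v := by
    intro v w hvw
    by_cases hw : w ∈ (p v).support
    · left
      have h1 : (p v).takeUntil w hw = SimpleGraph.Walk.cons hvw .nil :=
        congrArg Subtype.val ((hac.subsingleton_path _ _).elim ⟨_, (hp v).takeUntil hw⟩
          ⟨SimpleGraph.Walk.cons hvw .nil, by simp [hvw.ne]⟩)
      have h2 := congrArg SimpleGraph.Walk.snd ((p v).take_spec hw)
      rw [h1] at h2
      simpa using h2.symm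
    · right
      have := (huniq w (r v) (.cons hvw.symm (p v)) (hradj _ _ hvw.reachable)
        ((SimpleGraph.Walk.cons_isPath_iff _ _).2 ⟨hp v, hw⟩)).1
      simpa using this
  refine ⟨{ par := fun v => (p v).snd, depth := fun v => (p v).length, depth_lt := ?_,
            edge_eq := ?_, exists_edge := ?_, root_free := ?_ }⟩
  · intro c hc
    have h := (huniq _ (r c) (p c).tail (hradj _ _ (hreach c)) (hp c).tail).2
    have := SimpleGraph.Walk.length_tail_add_one (hnotnil c hc)
    omega
  · intro i
    have hi : Q.queryGraph.Adj (Q.src i) (Q.tgt i) := queryGraph_adj_iff.2 ⟨⟨i, rfl⟩, hloop i⟩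
    rcases hpar _ _ hi with h | h
    · exact ⟨Q.src i, h.trans_ne hi.ne', hypergraph_edge_eq (by rw [h])⟩
    · exact ⟨Q.tgt i, h.trans_ne hi.ne, hypergraph_edge_eq (by rw [h]; exact Sym2.eq_swap)⟩
  · intro c hc
    obtain ⟨⟨i, hi⟩, -⟩ := queryGraph_adj_iff.1 (SimpleGraph.Walk.adj_snd (hnotnil c hc))
    exact ⟨i, hypergraph_edge_eq hi⟩
  · intro c x hc hcf hx
    have key : Q.queryGraph.Reachable c x ∧ x ∈ Q.free := by
      clear hc hcf
      induction hx with
      | refl h => exact ⟨.rfl, h⟩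
      | step _ _ ih => exact ⟨(hreach _).symm.trans ih.1, ih.2⟩
    -- a vertex that is its own successor is the chosen root of its component
    have hcr : c = r c := by
      by_contra hne
      have hnil : ¬ (p c).Nil := fun h => hne h.eq
      exact (SimpleGraph.Walk.adj_snd hnil).ne hc.symm
    rw [hcr] at hcf
    exact hcf (hrtfree _ x key.2 (SimpleGraph.ConnectedComponent.sound key.1.symm))

variable (R : Q.hypergraph.Rooting)

/-- A query is trivial if and only if its only free variables are roots. -/
lemma isTrivial_iff_rooting : Q.IsTrivial ↔ ∀ X ∈ Q.free, R.par X = X := by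
  have hadj : ∀ {X Y}, Q.queryGraph.Adj X Y → R.par X = Y ∨ R.par Y = X := by
    intro X Y h
    obtain ⟨⟨i, hi⟩, hne⟩ := queryGraph_adj_iff.1 h
    obtain ⟨c, -, hc⟩ := R.edge_eq i
    rw [hypergraph_edge_eq hi] at hc
    have hX : X ∈ ({c, R.par c} : Set V) := hc ▸ .inl rfl
    have hY : Y ∈ ({c, R.par c} : Set V) := hc ▸ .inr rfl
    rcases hX with rfl | rfl <;> rcases hY with rfl | rfl
    exacts [absurd rfl hne, .inl rfl, .inr rfl, absurd rfl hne]
  have hadj' : ∀ {i a b}, a ∈ Q.hypergraph.edge i → b ∈ Q.hypergraph.edge i →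
      Q.queryGraph.Reachable a b := by
    intro i a b ha hb
    by_cases hab : a = b
    · rw [hab]
    · refine (queryGraph_adj_iff.2 ⟨⟨i, ?_⟩, hab⟩).reachable
      rcases ha with rfl | rfl <;> rcases hb with rfl | rfl
      exacts [absurd rfl hab, rfl, Sym2.eq_swap, absurd rfl hab]
  constructor
  · intro hT X hX
    by_contra hne
    have hlt := R.depth_lt X hne
    obtain ⟨i, hi⟩ := R.exists_subset_edge X
    have h1 : Q.queryGraph.Reachable X (R.par X) := hadj' (hi (.inl rfl)) (hi (.inr rfl))
    by_cases hp : R.par X ∈ Q.free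
    · exact hne (hT X hX _ hp h1).symm
    · obtain ⟨p, hpf, hpd, y, hy, j, hpj, hyj⟩ := R.exists_free_ancestor hp
        (R.exposed_subset_exposed_par hp (R.mem_exposed_self hX))
      have h2 : Q.queryGraph.Reachable (R.par X) y := by
        clear hyj
        induction hy with
        | refl => exact .rfl
        | tail _ h ih =>
          obtain ⟨-, l, hl, hl'⟩ := h
          exact ih.trans (hadj' hl hl')
      obtain rfl := hT X hX p hpf ((h1.trans h2).trans (hadj' hyj hpj))
      omega
  · intro hroot X hX Y hY ⟨w⟩
    -- being a descendant of the root `X` is invariant along edges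
    have key : ∀ {Z A}, Q.queryGraph.Walk Z A → R.par A = A → ∃ n, R.par^[n] Z = A := by
      intro Z A w hA
      induction w with
      | nil => exact ⟨0, rfl⟩
      | @cons a b c h _ ih =>
        obtain ⟨n, hn⟩ := ih hA
        rcases hadj h with h | h
        · exact ⟨n + 1, by rw [Function.iterate_succ_apply, h, hn]⟩
        · rcases n with _ | n
          · obtain rfl : b = c := hn
            exact ⟨0, h.symm.trans hA⟩
          · exact ⟨n, by rw [← h, ← Function.iterate_succ_apply, hn]⟩
    obtain ⟨n, hn⟩ := key w.reverse (hroot X hX)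
    rw [Function.iterate_fixed (hroot Y hY)] at hn
    exact hn.symm

end CRPQ

namespace CRPQ

variable {α : Type*} {V ι : Type u} {Q : CRPQ α V ι} (R : Q.hypergraph.Rooting) {k : ℕ}

/-! ### The expansion of a rooted acyclic query -/

/-- The end of the atom `i` that is the child of the other end. -/
noncomputable def child (i : ι) : V := (R.edge_eq i).choose

lemma par_child_ne (i : ι) : R.par (child R i) ≠ child R i := (R.edge_eq i).choose_spec.1

lemma pair_eq_child (i : ι) : ({Q.src i, Q.tgt i} : Set V) = {child R i, R.par (child R i)} :=
  (R.edge_eq i).choose_spec.2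

lemma child_cases (i : ι) : (child R i = Q.src i ∧ R.par (child R i) = Q.tgt i) ∨
    (child R i ≠ Q.src i ∧ child R i = Q.tgt i ∧ R.par (child R i) = Q.src i) := by
  have h := par_child_ne R i
  rcases Set.pair_eq_pair_iff.1 (pair_eq_child R i) with ⟨h1, h2⟩ | ⟨h1, h2⟩
  · exact .inl ⟨h1.symm, h2.symm⟩
  · exact .inr ⟨fun e => h (h1.symm.trans e.symm), h2.symm, h1.symm⟩

lemma child_injective (hQ : Q.IsAcyclic) : Function.Injective (child R) := by
  intro i j hij
  refine hQ.2.1 ?_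
  have h := (pair_eq_child R i).trans ((hij ▸ rfl : _ = _).trans (pair_eq_child R j).symm)
  exact Sym2.eq_iff.2 (Set.pair_eq_pair_iff.1 h)

lemma exists_child_eq {X : V} (hX : R.par X ≠ X) : ∃ i, child R i = X := by
  obtain ⟨i, hi⟩ := R.exists_edge X hX
  refine ⟨i, ?_⟩
  rcases Set.pair_eq_pair_iff.1 ((pair_eq_child R i).symm.trans hi) with ⟨h, -⟩ | ⟨h1, h2⟩
  · exact h
  · have h3 := R.depth_lt _ (par_child_ne R i)
    have h4 := R.depth_lt _ hX
    rw [h2, h1] at h3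
    omega

open Classical in
/-- The position, counted from the child end, of the `j`-th variable on the path of the atom `i`.
The same formula converts positions counted from the child end back. -/
noncomputable def pos (k : ℕ) (i : ι) (j : ℕ) : ℕ := if child R i = Q.src i then j else k - j

lemma pos_pos {i : ι} {j : ℕ} (hj : j ≤ k) : pos R k i (pos R k i j) = j := by
  unfold pos
  split_ifs <;> omega

lemma pos_mem {i : ι} {j : ℕ} (hj : j ∈ Set.Ioo 0 k) : pos R k i j ∈ Set.Ioo 0 k := by
  obtain ⟨h1, h2⟩ := hj
  unfold pos
  split_ifs
  · exact ⟨h1, h2⟩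
  · exact ⟨by omega, by omega⟩

/-- The `j`-th variable, counted from the child end, on the path that replaces the atom `i`. -/
noncomputable def upVar (k : ℕ) (i : ι) (j : ℕ) : ExpansionVar V ι k := Q.pathVar k i (pos R k i j)

lemma pathVar_mem {i : ι} {j : ℕ} (hj : j ∈ Set.Ioo 0 k) :
    Q.pathVar k i j = .inr (i, ⟨j, hj⟩) := by
  simp [pathVar, hj.1.ne', hj.2]

lemma upVar_mem {i : ι} {j : ℕ} (hj : j ∈ Set.Ioo 0 k) :
    upVar R k i j = .inr (i, ⟨pos R k i j, pos_mem R hj⟩) := pathVar_mem _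

lemma inr_eq_upVar (i : ι) (j : Set.Ioo 0 k) :
    (.inr (i, j) : ExpansionVar V ι k) = upVar R k i (pos R k i j) := by
  rw [upVar, pos_pos R j.2.2.le, pathVar_mem j.2]

lemma upVar_zero (hk : 1 ≤ k) (i : ι) : upVar R k i 0 = .inl (child R i) := by
  have : k ≠ 0 := by omega
  rcases child_cases R i with ⟨h, -⟩ | ⟨h, h', -⟩
  · simp [upVar, pos, pathVar, h]
  · rw [upVar, pos, if_neg h, h']
    simp [pathVar, this]

lemma upVar_last (hk : 1 ≤ k) (i : ι) : upVar R k i k = .inl (R.par (child R i)) := by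
  have : k ≠ 0 := by omega
  rcases child_cases R i with ⟨h, h'⟩ | ⟨h, -, h'⟩
  · rw [upVar, pos, if_pos h, h']
    simp [pathVar, this]
  · rw [upVar, pos, if_neg h, h']
    simp [pathVar]

lemma expansion_edge (hk : 1 ≤ k) (i : ι) (j : Fin k) :
    (Q.expansion k hk).hypergraph.edge (i, j) = {Q.pathVar k i j, Q.pathVar k i (j + 1)} := by
  change Set.range ![_, _] = _
  simp [Matrix.range_cons, Set.pair_comm]

lemma exists_upVar_edge (hk : 1 ≤ k) (i : ι) (j : Fin k) : ∃ l < k,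
    (Q.expansion k hk).hypergraph.edge (i, j) = {upVar R k i l, upVar R k i (l + 1)} := by
  have hj := j.2
  rw [expansion_edge]
  by_cases h : child R i = Q.src i
  · exact ⟨j, hj, by simp only [upVar, pos, if_pos h]⟩
  · refine ⟨k - 1 - j, by omega, ?_⟩
    simp only [upVar, pos, if_neg h]
    rw [Set.pair_comm]
    congr <;> omega

lemma exists_edge_upVar (hk : 1 ≤ k) (i : ι) {l : ℕ} (hl : l < k) : ∃ j,
    (Q.expansion k hk).hypergraph.edge (i, j) = {upVar R k i l, upVar R k i (l + 1)} := by
  by_cases h : child R i = Q.src i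
  · exact ⟨⟨l, hl⟩, by rw [expansion_edge]; simp only [upVar, pos, if_pos h]⟩
  · refine ⟨⟨k - 1 - l, by omega⟩, ?_⟩
    rw [expansion_edge]
    simp only [upVar, pos, if_neg h]
    rw [show k - 1 - l + 1 = k - l by omega, show k - (l + 1) = k - 1 - l by omega,
      Set.pair_comm]

/-- The variable of the query with the same exposed free variables as a given variable of the
expansion, if the latter is bound: for a fresh variable, the child end of its atom. -/
noncomputable def base : ExpansionVar V ι k → V
  | .inl X => X
  | .inr (i, _) => child R i

open Classical in
/-- The parent function of the expansion follows the paths towards their parent ends. -/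
noncomputable def expansionPar (k : ℕ) : ExpansionVar V ι k → ExpansionVar V ι k
  | .inl X => if hX : R.par X = X then .inl X else upVar R k (exists_child_eq R hX).choose 1
  | .inr (i, j) => upVar R k i (pos R k i j + 1)

/-- A depth function for `expansionPar`. As each atom becomes `k` steps, the depth in the query is
multiplied by `k`. -/
noncomputable def expansionDepth (k : ℕ) : ExpansionVar V ι k → ℕ
  | .inl X => k * R.depth X
  | .inr (i, j) => k * R.depth (child R i) - pos R k i j

lemma expansionPar_upVar (hQ : Q.IsAcyclic) (hk : 1 ≤ k) (i : ι) {j : ℕ} (hj : j < k) :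
    expansionPar R k (upVar R k i j) = upVar R k i (j + 1) := by
  rcases Nat.eq_zero_or_pos j with rfl | h0
  · rw [upVar_zero R hk, expansionPar, dif_neg (par_child_ne R i)]
    rw [child_injective R hQ (exists_child_eq R (par_child_ne R i)).choose_spec]
  · rw [upVar_mem R ⟨h0, hj⟩, expansionPar]
    simp only [pos_pos R hj.le]

lemma expansionDepth_upVar (hk : 1 ≤ k) (i : ι) {j : ℕ} (hj : j < k) :
    expansionDepth R k (upVar R k i j) = k * R.depth (child R i) - j := by
  rcases Nat.eq_zero_or_pos j with rfl | h0
  · rw [upVar_zero R hk]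
    rfl
  · rw [upVar_mem R ⟨h0, hj⟩, expansionDepth]
    simp only [pos_pos R hj.le]

lemma expansionPar_inl_root {X : V} (hX : R.par X = X) :
    expansionPar R k (.inl X) = .inl X := by
  rw [expansionPar, dif_pos hX]

lemma exists_eq_upVar (hk : 1 ≤ k) (c : ExpansionVar V ι k) :
    (∃ X, R.par X = X ∧ c = .inl X) ∨ ∃ i, ∃ j < k, c = upVar R k i j := by
  rcases c with X | ⟨i, j⟩
  · by_cases hX : R.par X = X
    · exact .inl ⟨X, hX, rfl⟩
    · obtain ⟨i, rfl⟩ := exists_child_eq R hX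
      exact .inr ⟨i, 0, hk, (upVar_zero R hk i).symm⟩
  · exact .inr ⟨i, _, (pos_mem R j.2).2, inr_eq_upVar R i j⟩

lemma expansionDepth_upVar_succ_lt (hk : 1 ≤ k) (i : ι) {j : ℕ} (hj : j < k) :
    expansionDepth R k (upVar R k i (j + 1)) < expansionDepth R k (upVar R k i j) := by
  have hlt := R.depth_lt _ (par_child_ne R i)
  have hmul : k * (R.depth (R.par (child R i)) + 1) ≤ k * R.depth (child R i) :=
    Nat.mul_le_mul_left k hlt
  rw [mul_add] at hmul
  rw [expansionDepth_upVar R hk i hj]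
  rcases Nat.lt_or_ge (j + 1) k with h | h
  · rw [expansionDepth_upVar R hk i h]
    omega
  · obtain rfl : k = j + 1 := by omega
    rw [upVar_last R hk, expansionDepth]
    omega

lemma inr_not_mem_free (hk : 1 ≤ k) (p : ι × Set.Ioo 0 k) :
    (.inr p : ExpansionVar V ι k) ∉ (Q.expansion k hk).hypergraph.free := by
  rintro ⟨X, -, h⟩
  cases h

lemma inl_mem_free_iff (hk : 1 ≤ k) {X : V} :
    (.inl X : ExpansionVar V ι k) ∈ (Q.expansion k hk).hypergraph.free ↔ X ∈ Q.free :=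
  Sum.inl_injective.mem_set_image

open QueryHypergraph

lemma exists_exposed_base (hQ : Q.IsAcyclic) (hk : 1 ≤ k) {c x : ExpansionVar V ι k}
    (h : Exposed (expansionPar R k) (Q.expansion k hk).hypergraph.free c x) :
    ∃ X ∈ R.exposed (base R c), x = .inl X := by
  induction h with
  | refl h =>
    obtain ⟨X, hX, rfl⟩ := h
    exact ⟨X, R.mem_exposed_self hX, rfl⟩
  | @step c x _ hc ih =>
    obtain ⟨X, hX, rfl⟩ := ih
    refine ⟨X, ?_, rfl⟩
    rcases exists_eq_upVar R hk c with ⟨Y, hY, rfl⟩ | ⟨i, j, hj, rfl⟩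
    · rwa [expansionPar_inl_root R hY]
    · have hbase : base R (upVar R k i j) = child R i := by
        rcases Nat.eq_zero_or_pos j with rfl | h0
        · rw [upVar_zero R hk, base]
        · rw [upVar_mem R ⟨h0, hj⟩, base]
      rw [hbase] at hX
      rw [expansionPar_upVar R hQ hk i hj] at hc ⊢
      rcases Nat.lt_or_ge (j + 1) k with h | h
      · rwa [upVar_mem R ⟨j.succ_pos, h⟩, base]
      · obtain rfl : k = j + 1 := by omega
        rw [upVar_last R hk] at hc ⊢
        exact R.exposed_subset_exposed_par (fun h => hc ((inl_mem_free_iff hk).2 h)) hX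

/-- The subdivided rooted forest. -/
noncomputable def expansionRooting (hQ : Q.IsAcyclic) (hk : 1 ≤ k) :
    (Q.expansion k hk).hypergraph.Rooting where
  par := expansionPar R k
  depth := expansionDepth R k
  depth_lt c hc := by
    rcases exists_eq_upVar R hk c with ⟨Y, hY, rfl⟩ | ⟨i, j, hj, rfl⟩
    · exact absurd (expansionPar_inl_root R hY) hc
    · rw [expansionPar_upVar R hQ hk i hj]
      exact expansionDepth_upVar_succ_lt R hk i hj
  edge_eq := by
    rintro ⟨i, j⟩
    obtain ⟨l, hl, h⟩ := exists_upVar_edge R hk i j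
    refine ⟨upVar R k i l, fun e => ?_, by rw [expansionPar_upVar R hQ hk i hl, h]⟩
    have := expansionDepth_upVar_succ_lt R hk i hl
    rw [← expansionPar_upVar R hQ hk i hl, e] at this
    exact lt_irrefl _ this
  exists_edge c hc := by
    rcases exists_eq_upVar R hk c with ⟨Y, hY, rfl⟩ | ⟨i, j, hj, rfl⟩
    · exact absurd (expansionPar_inl_root R hY) hc
    · rw [expansionPar_upVar R hQ hk i hj]
      obtain ⟨l, hl⟩ := exists_edge_upVar R hk i hj
      exact ⟨(i, l), hl⟩
  root_free c x hc hcf hx := by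
    rcases exists_eq_upVar R hk c with ⟨Y, hY, rfl⟩ | ⟨i, j, hj, rfl⟩
    · obtain ⟨X, hX, -⟩ := exists_exposed_base R hQ hk hx
      exact R.root_free Y X hY (fun h => hcf ((inl_mem_free_iff hk).2 h)) hX
    · have := expansionDepth_upVar_succ_lt R hk i hj
      rw [← expansionPar_upVar R hQ hk i hj, hc] at this
      exact lt_irrefl _ this

lemma inl_mem_exposed (hQ : Q.IsAcyclic) (hk : 1 ≤ k) {c x : V} (hx : x ∈ R.exposed c) :
    .inl x ∈ (expansionRooting R hQ hk).exposed (.inl c) := by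
  induction hx with
  | refl h => exact Rooting.mem_exposed_self _ ((inl_mem_free_iff hk).2 h)
  | @step d x _ hd ih =>
    by_cases hpar : R.par d = d
    · rwa [hpar]
    · obtain ⟨i, rfl⟩ := exists_child_eq R hpar
      have key : ∀ j ≤ k, .inl x ∈ (expansionRooting R hQ hk).exposed (upVar R k i j) := by
        intro j
        induction j with
        | zero => exact fun _ => by rwa [upVar_zero R hk]
        | succ j ihj =>
          intro hj
          have hp : (expansionRooting R hQ hk).par (upVar R k i j) = upVar R k i (j + 1) :=
            expansionPar_upVar R hQ hk i hj
          rw [← hp]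
          refine Rooting.exposed_subset_exposed_par _ ?_ (ihj (by omega))
          rw [hp]
          rcases hj.lt_or_eq with h | rfl
          · rw [upVar_mem R ⟨j.succ_pos, h⟩]
            exact inr_not_mem_free hk _
          · rw [upVar_last R hk, inl_mem_free_iff hk]
            exact hd
      have := key k le_rfl
      rwa [upVar_last R hk] at this

variable [Fintype ι]

lemma ncard_exposed_expansion_le (hQ : Q.IsAcyclic) (hk : 1 ≤ k) (c : ExpansionVar V ι k) :
    ((expansionRooting R hQ hk).exposed c).ncard ≤ (R.exposed (base R c)).ncard := by
  have := Q.finite_var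
  refine (Set.ncard_le_ncard (t := Sum.inl '' R.exposed (base R c)) ?_ (Set.toFinite _)).trans
    (Set.ncard_image_le (Set.toFinite _))
  intro x hx
  obtain ⟨X, hX, rfl⟩ := exists_exposed_base R hQ hk hx
  exact ⟨X, hX, rfl⟩

lemma ncard_exposed_le_expansion (hQ : Q.IsAcyclic) (hk : 1 ≤ k) (c : V) :
    (R.exposed c).ncard ≤ ((expansionRooting R hQ hk).exposed (.inl c)).ncard := by
  have := Q.finite_var
  rw [← Set.ncard_image_of_injective _ (Sum.inl_injective (β := ι × Set.Ioo 0 k))]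
  refine Set.ncard_le_ncard ?_ (Set.toFinite _)
  rintro _ ⟨x, hx, rfl⟩
  exact inl_mem_exposed R hQ hk hx

lemma one_le_fnfhtw_expansion (hQ : Q.IsAcyclic) (hk : 1 ≤ k) :
    1 ≤ (Q.expansion k hk).fnfhtw := by
  have := Q.finite_var
  have := Q.nonempty_var
  obtain ⟨R⟩ := exists_rooting hQ
  exact (expansionRooting R hQ hk).one_le_fnfhtw

lemma fnfhtw_expansion_of_isTrivial (hQ : Q.IsAcyclic) (hk : 1 ≤ k) (hT : Q.IsTrivial) :
    (Q.expansion k hk).fnfhtw = 1 := by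
  have := Q.finite_var
  obtain ⟨R⟩ := exists_rooting hQ
  refine le_antisymm ((expansionRooting R hQ hk).fnfhtw_le le_rfl ?_)
    (one_le_fnfhtw_expansion hQ hk)
  rintro c hc ⟨x, hx⟩
  -- the exposed variable `X` is a root, so it is `base R c` itself; but a fresh variable lies on
  -- the edge from a variable that is not a root
  obtain ⟨X, hX, -⟩ := exists_exposed_base R hQ hk hx
  have hXf := R.exposed_subset_free _ hX
  have hXr := (isTrivial_iff_rooting R).1 hT X hXf
  have hXc : X = base R c :=
    (R.eq_or_par_not_mem_free hX).resolve_right fun h => h (hXr.symm ▸ hXf)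
  rcases c with c | ⟨i, j⟩
  · obtain rfl : X = c := hXc
    exact absurd ((inl_mem_free_iff hk).2 hXf) hc
  · obtain rfl : X = child R i := hXc
    exact absurd hXr (par_child_ne R i)

/-- The fresh variable next to a free non-root variable separates it from the free variables
above. -/
lemma two_le_fnfhtw_expansion (hQ : Q.IsAcyclic) (hk : 2 ≤ k) (hT : ¬ Q.IsTrivial) :
    2 ≤ (Q.expansion k (one_le_two.trans hk)).fnfhtw := by
  have := Q.finite_var
  obtain ⟨R⟩ := exists_rooting hQ
  rw [isTrivial_iff_rooting R] at hT
  push Not at hT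
  obtain ⟨X, hX, hne⟩ := hT
  obtain ⟨i, rfl⟩ := exists_child_eq R hne
  have hk1 : 1 ≤ k := one_le_two.trans hk
  have hz : upVar R k i 1 ∉ (Q.expansion k hk1).hypergraph.free := by
    rw [upVar_mem R ⟨one_pos, hk⟩]
    exact inr_not_mem_free hk1 _
  have hp : (expansionRooting R hQ hk1).par (.inl (child R i)) = upVar R k i 1 := by
    rw [← upVar_zero R hk1]
    exact expansionPar_upVar R hQ hk1 i hk1
  have hmem : .inl (child R i) ∈ (expansionRooting R hQ hk1).exposed (upVar R k i 1) := by
    rw [← hp]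
    refine Rooting.exposed_subset_exposed_par _ (by rwa [hp])
      (Rooting.mem_exposed_self _ ((inl_mem_free_iff hk1).2 hX))
  have hcard : 1 ≤ ((expansionRooting R hQ hk1).exposed (upVar R k i 1)).ncard :=
    (Set.ncard_pos (Set.toFinite _)).2 ⟨_, hmem⟩
  have hle := (expansionRooting R hQ hk1).ncard_exposed_add_one_le_fnfhtw hz ⟨_, hmem⟩
  have : (1 : ℝ) ≤ ((expansionRooting R hQ hk1).exposed (upVar R k i 1)).ncard := by
    exact_mod_cast hcard
  change (2 : ℝ) ≤ (Q.expansion k hk1).hypergraph.fnfhtw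
  linarith

lemma fnfhtw_le_fnfhtw_expansion (hQ : Q.IsAcyclic) (hk : 1 ≤ k) :
    Q.fnfhtw ≤ (Q.expansion k hk).fnfhtw := by
  have := Q.finite_var
  obtain ⟨R⟩ := exists_rooting hQ
  refine R.fnfhtw_le (one_le_fnfhtw_expansion hQ hk) fun c hc ⟨x, hx⟩ => ?_
  refine le_trans ?_ ((expansionRooting R hQ hk).ncard_exposed_add_one_le_fnfhtw
    (fun h => hc ((inl_mem_free_iff hk).1 h)) ⟨_, inl_mem_exposed R hQ hk hx⟩)
  have := ncard_exposed_le_expansion R hQ hk c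
  gcongr

lemma fnfhtw_expansion_le (hQ : Q.IsAcyclic) (hk : 1 ≤ k) :
    (Q.expansion k hk).fnfhtw ≤ max Q.fnfhtw 2 := by
  have := Q.finite_var
  obtain ⟨R⟩ := exists_rooting hQ
  refine (expansionRooting R hQ hk).fnfhtw_le (one_le_two.trans (le_max_right _ _))
    fun c hc ⟨x, hx⟩ => ?_
  obtain ⟨X, hX, -⟩ := exists_exposed_base R hQ hk hx
  have hcard : (((expansionRooting R hQ hk).exposed c).ncard : ℝ) ≤ (R.exposed (base R c)).ncard :=
    by exact_mod_cast ncard_exposed_expansion_le R hQ hk c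
  by_cases hb : base R c ∈ Q.hypergraph.free
  · refine le_max_of_le_right ?_
    rw [R.exposed_of_mem_free hb, Set.ncard_singleton] at hcard
    rw [Nat.cast_one] at hcard
    linarith
  · refine le_max_of_le_left ((add_le_add_left hcard 1).trans ?_)
    exact R.ncard_exposed_add_one_le_fnfhtw hb ⟨X, hX⟩

end CRPQ

theorem mainTheorem2 {α : Type*} {V ι : Type u} [Fintype ι] (Q : CRPQ α V ι)
    (hQ : Q.IsAcyclic) (k : ℕ) (hk : 2 ≤ k) :
    (Q.IsTrivial → (Q.expansion k (one_le_two.trans hk)).fnfhtw = 1) ∧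
    (¬ Q.IsTrivial →
      (Q.expansion k (one_le_two.trans hk)).fnfhtw = max Q.fnfhtw 2 ∧
      ∀ N OUT : ℕ,
        (Q.expansion k (one_le_two.trans hk)).runtimeBound N OUT = Q.runtimeBound N OUT) := by
  refine ⟨CRPQ.fnfhtw_expansion_of_isTrivial hQ _, fun hT => ?_⟩
  have h : (Q.expansion k (one_le_two.trans hk)).fnfhtw = max Q.fnfhtw 2 :=
    le_antisymm (CRPQ.fnfhtw_expansion_le hQ _)
      (max_le (CRPQ.fnfhtw_le_fnfhtw_expansion hQ _) (CRPQ.two_le_fnfhtw_expansion hQ hk hT))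
  exact ⟨h, fun N OUT => by rw [CQ.runtimeBound, CRPQ.runtimeBound, h]⟩
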